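/- Let $\mathcal{L}$ be a first-order language extending the language of rings, and let $\mathcal{K}$ be an $\mathcal{L}$-structure expanding a field $K$ of characteristic $0$, equipped with a field topology that is definable: there is an $\mathcal{L}$-formula $\chi(x,z)$, $z=(z_1,\dots,z_k)$, such that the sets $\chi(K,a)$, $a\in K^k$, form a basis of neighbourhoods of $0$. Let $\delta$ be a derivation on $K$ and write $\mathcal{K}_\delta$ for the expansion of $\mathcal{K}$ by $\delta$. An element $x$ of an elementary extension of $\mathcal{K}$ is called $K$-infinitesimal if it satisfies every $\mathcal{L}$-formula with parameters in $K$ that defines in $K$ an open set containing $0$. The field $K$ is large if every irreducible curve over $K$ with a smooth $K$-rational point has infinitely many $K$-rational points. The topological field $K$ is c-large if it is large and, for every $n\in\mathbb{N}$, there are a non-principal ultrapower $\mathcal{K}^*$ of $\mathcal{K}$ and an embedding over $K$ of the field $K((s_0,\dots,s_{n-1}))=\mathrm{Frac}\,K[[s_0,\dots,s_{n-1}]]$ into $K^*$ that maps the maximal ideal of $K[[s_0,\dots,s_{n-1}]]$ (the power series with zero constant term; in particular each $s_i$) into the $K$-infinitesimal elements of $K^*$. For a differential polynomial $P$ in one indeterminate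 $x$, of order $m\geq 0$, over a differential field $(F,\delta)$, let $P^*\in F[x_0,\dots,x_m]$ be the ordinary polynomial with $P(x)=P^*(x,\delta x,\dots,\delta^m x)$, and let $s_P=\partial P/\partial(\delta^m x)$ be its separant. An $\mathcal{L}$-structure $\mathcal F$ expanding a field $F$, together with a derivation $\delta$ of $F$, is a model of the scheme (DL) if for every such $P$ over $F$, all $u_0,\dots,u_m\in F^k$ and every $y\in F^{m+1}$ with $P^*(y)=0$ and $s_P^*(y)\neq 0$, there is $x\in F$ with $P(x)=0$, $s_P(x)\neq 0$ and $\delta^i(x)-y_i\in\chi(F,u_i)$ for $0\le i\le m$. Proposition. If $K$ is c-large, then $\mathcal{K}_\delta$ embeds (by an $\mathcal{L}$-embedding commuting with the derivations) into a structure $\mathcal{K}'_{\delta'}$, where $\mathcal{K}'$ expands a field and $\delta'$ is a derivation on it, such that $\mathcal{K}'_{\delta'}$ is a model of the scheme (DL) and $\mathcal{K}'$ has the same $\mathcal{L}$-theory as $\mathcal{K}$. -/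

import Mathlib

open scoped FirstOrder Topology

universe u v w

/-- The `L`-structure `K` expands the field `K`: the symbols `+, *, -, 0, 1` of the language of
rings, viewed in `L` through `ι`, are interpreted by the field operations. -/
structure IsFieldExpansion {L : FirstOrder.Language.{u, v}} (ι : FirstOrder.Language.ring →ᴸ L)
    (K : Type w) [Field K] [L.Structure K] : Prop where
  add : ∀ x y : K, FirstOrder.Language.Structure.funMap (ι.onFunction FirstOrder.ringFunc.add) ![x, y] = x + y
  mul : ∀ x y : K, FirstOrder.Language.Structure.funMap (ι.onFunction FirstOrder.ringFunc.mul) ![x, y] = x * y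
  neg : ∀ x : K, FirstOrder.Language.Structure.funMap (ι.onFunction FirstOrder.ringFunc.neg) ![x] = -x
  zero : FirstOrder.Language.Structure.funMap (ι.onFunction FirstOrder.ringFunc.zero) ![] = (0 : K)
  one : FirstOrder.Language.Structure.funMap (ι.onFunction FirstOrder.ringFunc.one) ![] = (1 : K)

/-- The set `χ(K, a)` defined by the formula `χ(x, z)` at the parameters `z = a`. -/
def basicNhd {L : FirstOrder.Language.{u, v}} {k : ℕ} (χ : L.Formula (Fin 1 ⊕ Fin k))
    (K : Type w) [L.Structure K] (a : Fin k → K) : Set K :=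
  {x | χ.Realize (Sum.elim ![x] a)}

/-- The topology of `K` is definable through `χ`: the sets `χ(K, a)`, for `a` in `K`, form a
basis of neighbourhoods of `0`. -/
def IsNhdBasisFormula {L : FirstOrder.Language.{u, v}} {k : ℕ} (χ : L.Formula (Fin 1 ⊕ Fin k))
    (K : Type w) [Field K] [L.Structure K] [TopologicalSpace K] : Prop :=
  (𝓝 (0 : K)).HasBasis (fun _ : Fin k → K => True) (basicNhd χ K)

section Differential

/-- Differential polynomials in one differential indeterminate `x`; the variable `X i` stands
for `δ^i x`. -/
abbrev DiffPoly (K : Type w) [Field K] : Type w := MvPolynomial ℕ K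

namespace DiffPoly

variable {K : Type w} [Field K]

/-- `P` has order `m`: `δ^m x` occurs in `P`, and no `δ^i x` with `i > m` does. -/
def HasOrder (P : DiffPoly K) (m : ℕ) : Prop :=
  m ∈ P.vars ∧ ∀ i ∈ P.vars, i ≤ m

/-- The separant `∂P/∂(δ^m x)` of a differential polynomial of order `m`. -/
noncomputable def separant (m : ℕ) (P : DiffPoly K) : DiffPoly K :=
  MvPolynomial.pderiv m P

/-- The value `P(x)` in the differential field `(K, δ)`. -/
noncomputable def evalAt (δ : Derivation ℤ K K) (x : K) (P : DiffPoly K) : K :=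
  MvPolynomial.eval (fun i => δ^[i] x) P

/-- For `P` of order at most `m`, the ordinary polynomial `P^*` in the variables
`x_0, …, x_m` with `P(x) = P^*(x, δ x, …, δ^m x)`. -/
noncomputable def star (m : ℕ) (P : DiffPoly K) : MvPolynomial (Fin (m + 1)) K :=
  MvPolynomial.aeval
    (fun i => if h : i < m + 1 then MvPolynomial.X (⟨i, h⟩ : Fin (m + 1)) else 0) P

end DiffPoly

/-- The expansion `(K, δ)` of the `L`-structure `K` satisfies the axiom scheme (DL) with respect
to the formula `χ`: for every differential polynomial `P` of order `m`, all parameters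
`u_0, …, u_m` and every `y` with `P^*(y) = 0` and `s_P^*(y) ≠ 0`, there is `x` with `P(x) = 0`,
`s_P(x) ≠ 0` and `δ^i x - y_i ∈ χ(K, u_i)` for `i ≤ m`. -/
def ModelsDL {L : FirstOrder.Language.{u, v}} {k : ℕ} (χ : L.Formula (Fin 1 ⊕ Fin k))
    {K : Type w} [Field K] [L.Structure K] (δ : Derivation ℤ K K) : Prop :=
  ∀ (m : ℕ) (P : DiffPoly K), P.HasOrder m →
    ∀ (u : Fin (m + 1) → Fin k → K) (y : Fin (m + 1) → K),
      MvPolynomial.eval y (P.star m) = 0 →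
      MvPolynomial.eval y ((P.separant m).star m) ≠ 0 →
      ∃ x : K, P.evalAt δ x = 0 ∧ (P.separant m).evalAt δ x ≠ 0 ∧
        ∀ i : Fin (m + 1), δ^[i] x - y i ∈ basicNhd χ K (u i)

end Differential

section Large

/-- `K` is large: every irreducible plane curve over `K` with a smooth `K`-rational point has
infinitely many `K`-rational points. -/
def IsLargeField (K : Type w) [Field K] : Prop :=
  ∀ f : MvPolynomial (Fin 2) K, Irreducible f →
    (∃ a : Fin 2 → K, MvPolynomial.eval a f = 0 ∧
      ∃ i, MvPolynomial.eval a (MvPolynomial.pderiv i f) ≠ 0) →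
    {a : Fin 2 → K | MvPolynomial.eval a f = 0}.Infinite

/-- The ultrapower of `K` with respect to the ultrafilter `U`. -/
abbrev Ultrapower {I : Type w} (U : Ultrafilter I) (K : Type w) : Type w :=
  (U : Filter I).Product (fun _ => K)

/-- The field structure of an ultrapower, computed on representatives. -/
noncomputable instance Ultrapower.instField {I : Type w} (U : Ultrafilter I)
    (K : Type w) [Field K] : Field (Ultrapower U K) :=
  inferInstanceAs (Field (Filter.Germ (U : Filter I) K))

/-- The diagonal embedding of `K` into its ultrapower. -/
def Ultrapower.diag {I : Type w} (U : Ultrafilter I) (K : Type w) (a : K) : Ultrapower U K :=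
  Quotient.mk _ (fun _ => a)

/-- Let `N` be an extension of `K`, given with names for the elements of `K`. An element `x` of
`N` is `K`-infinitesimal, `x ∼_K 0`, if it satisfies every formula with parameters in `K` that
defines in `K` an open set containing `0`. -/
def IsInfinitesimal (L : FirstOrder.Language.{u, v}) (K : Type w) [Field K] [L.Structure K]
    [TopologicalSpace K] {N : Type w} [L[[K]].Structure N] (x : N) : Prop :=
  ∀ φ : L[[K]].Formula (Fin 1),
    IsOpen {a : K | φ.Realize ![a]} → φ.Realize ![(0 : K)] → φ.Realize ![x]

/-- `K` is c-large: it is large and, for every `n`, there is an embedding over `K` of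
`K((s_0, …, s_{n-1}))`, the fraction field of `K[[s_0, …, s_{n-1}]]`, into a nonprincipal
ultrapower of `K` that maps the maximal ideal of `K[[s_0, …, s_{n-1}]]` into the
`K`-infinitesimals. -/
def IsCLarge (L : FirstOrder.Language.{u, v}) (K : Type w) [Field K] [L.Structure K]
    [TopologicalSpace K] : Prop :=
  IsLargeField K ∧
    ∀ n : ℕ, ∃ (I : Type w) (U : Ultrafilter I), (∀ i : I, {i} ∉ U) ∧
      ∃ σ : FractionRing (MvPowerSeries (Fin n) K) →+* Ultrapower U K,
        (∀ a : K, σ (algebraMap (MvPowerSeries (Fin n) K) _ (MvPowerSeries.C a)) =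
          Ultrapower.diag U K a) ∧
        ∀ f ∈ IsLocalRing.maximalIdeal (MvPowerSeries (Fin n) K),
          IsInfinitesimal L K (σ (algebraMap (MvPowerSeries (Fin n) K) _ f))

end Large

open FirstOrder FirstOrder.Language

/-! The key property is `HasDenseZeros`: near a zero of `f` at which the last partial derivative
does not vanish, there are zeros whose first `m` coordinates avoid any prescribed proper Zariski
closed set `q = 0`. A c-large field has it (`IsCLarge.hasDenseZeros`): move the first coordinates
along a line `y + s(z - y)` with `q(z) ≠ 0`, solve for the last one by Newton iteration in `K[[s]]`,
send the resulting point, infinitely close to `y`, into an ultrapower, and return to `K` by Łoś's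
theorem. The property passes to ultrapowers.

Over a differential field `F` with this property, some ultrapower contains, for all systems over `F`
at once, nearby zeros whose first `m` coordinates are jointly algebraically independent over `F`. In
characteristic zero a derivation extends with arbitrary values on independent elements, so it can be
made to send each coordinate of each zero to the next one. The zeroth coordinate `x` then has jet
`(x, δx, …, δ^m x)` equal to that zero, so it solves the system
(`HasDenseZeros.exists_ultrapower_derivation`).

Iterating gives an elementary chain of ultrapowers. An instance of (DL) over its union involves
finitely many elements, hence lives at some stage and is solved at the next. -/

theorem MvPolynomial.eval_map_comp {R S τ : Type*} [CommSemiring R] [CommSemiring S]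
    (φ : R →+* S) (a : τ → R) (f : MvPolynomial τ R) :
    MvPolynomial.eval (fun t => φ (a t)) (MvPolynomial.map φ f) = φ (MvPolynomial.eval a f) := by
  rw [MvPolynomial.eval_map, MvPolynomial.eval, MvPolynomial.map_eval₂Hom, RingHom.comp_id,
    MvPolynomial.coe_eval₂Hom]

/-! ### Łoś's theorem for polynomials and formulas. -/

namespace Ultrapower

variable {I : Type w} (U : Ultrafilter I) (K : Type w) [Field K]

/-- The class of a family in the ultrapower, as a ring homomorphism. -/
noncomputable def mkHom : (I → K) →+* Ultrapower U K :=
  (Filter.Germ.coeRingHom (U : Filter I) : (I → K) →+* Filter.Germ (U : Filter I) K)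

theorem mkHom_surjective : Function.Surjective (mkHom U K) := fun x =>
  Quotient.inductionOn' x fun a => ⟨a, rfl⟩

variable {U K}

theorem mkHom_eq_iff {a b : I → K} : mkHom U K a = mkHom U K b ↔ ∀ᶠ i in U, a i = b i :=
  Filter.Germ.coe_eq

theorem mkHom_eq_zero_iff {a : I → K} : mkHom U K a = 0 ↔ ∀ᶠ i in U, a i = 0 := by
  rw [← map_zero (mkHom U K), mkHom_eq_iff]; rfl

theorem mkHom_ne_zero_iff {a : I → K} : mkHom U K a ≠ 0 ↔ ∀ᶠ i in U, a i ≠ 0 := by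
  rw [Ne, mkHom_eq_zero_iff, ← Ultrafilter.eventually_not]

variable (U K) in
/-- The diagonal embedding as a ring homomorphism. -/
noncomputable def diagHom : K →+* Ultrapower U K :=
  (mkHom U K).comp (Pi.constRingHom I K)

theorem mkHom_const (a : K) : mkHom U K (fun _ => a) = diagHom U K a := rfl

/-- Evaluation of polynomials in an ultrapower is computed on representatives. -/
theorem eval_map_mkHom {τ : Type*} (f : MvPolynomial τ (I → K)) (a : τ → I → K) :
    MvPolynomial.eval (fun t => mkHom U K (a t)) (MvPolynomial.map (mkHom U K) f) =
      mkHom U K (fun i => MvPolynomial.eval (fun t => a t i)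
        (MvPolynomial.map (Pi.evalRingHom (fun _ => K) i) f)) := by
  have h : (fun i => MvPolynomial.eval (fun t => a t i)
      (MvPolynomial.map (Pi.evalRingHom (fun _ => K) i) f)) = MvPolynomial.eval a f := by
    funext i
    exact (MvPolynomial.eval_map_comp (Pi.evalRingHom (fun _ => K) i) a f)
  rw [h]
  exact MvPolynomial.eval_map_comp (mkHom U K) a f

theorem eval_map_diagHom {τ : Type*} (f : MvPolynomial τ K) (a : τ → I → K) :
    MvPolynomial.eval (fun t => mkHom U K (a t)) (MvPolynomial.map (diagHom U K) f) =
      mkHom U K (fun i => MvPolynomial.eval (fun t => a t i) f) := by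
  rw [diagHom, ← MvPolynomial.map_map, eval_map_mkHom]
  congr 1
  funext i
  rw [MvPolynomial.map_map]
  congr 1
  exact MvPolynomial.map_id f

variable {L : FirstOrder.Language.{u, v}} [L.Structure K]

theorem realize_mkHom {β : Type*} (φ : L.Formula β) (x : β → I → K) :
    φ.Realize (fun b => mkHom U K (x b)) ↔ ∀ᶠ i in U, φ.Realize (fun b => x b i) :=
  Ultraproduct.realize_formula_cast (M := fun _ => K) (u := U) φ x

theorem mem_basicNhd_mkHom {k : ℕ} (χ : L.Formula (Fin 1 ⊕ Fin k)) (x : I → K)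
    (a : Fin k → I → K) :
    mkHom U K x ∈ basicNhd χ (Ultrapower U K) (fun t => mkHom U K (a t)) ↔
      ∀ᶠ i in U, x i ∈ basicNhd χ K (fun t => a t i) := by
  have := realize_mkHom (U := U) χ (Sum.elim ![x] a)
  simp only [basicNhd, Set.mem_ofPred_eq]
  convert this using 2
  · funext b
    rcases b with b | b
    · fin_cases b; rfl
    · rfl
  · funext i
    congr 1
    funext b
    rcases b with b | b
    · fin_cases b; rfl
    · rfl

theorem funMap_mkHom {n : ℕ} (f : L.Functions n) (x : Fin n → I → K) :
    Structure.funMap f (fun j => mkHom U K (x j)) =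
      mkHom U K (fun i => Structure.funMap f fun j => x j i) :=
  Ultraproduct.funMap_cast (M := fun _ => K) (u := U) f x

theorem isFieldExpansion {ι : FirstOrder.Language.ring →ᴸ L} (hK : IsFieldExpansion ι K) :
    IsFieldExpansion ι (Ultrapower U K) where
  add x y := by
    obtain ⟨a, rfl⟩ := mkHom_surjective U K x
    obtain ⟨b, rfl⟩ := mkHom_surjective U K y
    rw [← map_add, show (![mkHom U K a, mkHom U K b] : Fin 2 → Ultrapower U K) =
        fun j => mkHom U K ((![a, b] : Fin 2 → I → K) j) from
      funext fun j => by fin_cases j <;> rfl, funMap_mkHom]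
    congr 1
    funext i
    rw [Pi.add_apply, ← hK.add]
    congr 1; funext j; fin_cases j <;> rfl
  mul x y := by
    obtain ⟨a, rfl⟩ := mkHom_surjective U K x
    obtain ⟨b, rfl⟩ := mkHom_surjective U K y
    rw [← map_mul, show (![mkHom U K a, mkHom U K b] : Fin 2 → Ultrapower U K) =
        fun j => mkHom U K ((![a, b] : Fin 2 → I → K) j) from
      funext fun j => by fin_cases j <;> rfl, funMap_mkHom]
    congr 1
    funext i
    rw [Pi.mul_apply, ← hK.mul]
    congr 1; funext j; fin_cases j <;> rfl
  neg x := by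
    obtain ⟨a, rfl⟩ := mkHom_surjective U K x
    rw [← map_neg, show (![mkHom U K a] : Fin 1 → Ultrapower U K) =
        fun j => mkHom U K ((![a] : Fin 1 → I → K) j) from
      funext fun j => by fin_cases j; rfl, funMap_mkHom]
    congr 1
    funext i
    rw [Pi.neg_apply, ← hK.neg]
    congr 1; funext j; fin_cases j; rfl
  zero := by
    rw [← map_zero (mkHom U K), show (![] : Fin 0 → Ultrapower U K) =
        fun j => mkHom U K ((![] : Fin 0 → I → K) j) from
      funext fun j => by exact j.elim0, funMap_mkHom]
    congr 1
    funext i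
    rw [Pi.zero_apply, ← hK.zero]
    congr 1; funext j; exact j.elim0
  one := by
    rw [← map_one (mkHom U K), show (![] : Fin 0 → Ultrapower U K) =
        fun j => mkHom U K ((![] : Fin 0 → I → K) j) from
      funext fun j => by exact j.elim0, funMap_mkHom]
    congr 1
    funext i
    rw [Pi.one_apply, ← hK.one]
    congr 1; funext j; exact j.elim0

variable (U K L) in
/-- The diagonal embedding into an ultrapower is elementary. -/
noncomputable def diagElementary : K ↪ₑ[L] Ultrapower U K where
  toFun := diagHom U K
  map_formula' n φ x := by
    refine (realize_mkHom (U := U) φ (fun b _ => x b)).trans ?_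
    exact Filter.eventually_const

end Ultrapower

/-! ### Zariski density of zeros, and its passage to ultrapowers. -/

/-- Every hypersurface `f = 0` with a point `y` at which the derivative of `f` in the last variable
does not vanish has, in every basic neighbourhood of `y`, points whose first coordinates avoid a
given proper closed subset of affine space. -/
def HasDenseZeros {L : FirstOrder.Language.{u, v}} {k : ℕ} (χ : L.Formula (Fin 1 ⊕ Fin k))
    (F : Type w) [Field F] [L.Structure F] : Prop :=
  ∀ (m : ℕ) (f : MvPolynomial (Fin (m + 1)) F) (y : Fin (m + 1) → F)
    (u : Fin (m + 1) → Fin k → F) (q : MvPolynomial (Fin m) F),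
    MvPolynomial.eval y f = 0 →
    MvPolynomial.eval y (MvPolynomial.pderiv (Fin.last m) f) ≠ 0 → q ≠ 0 →
    ∃ a : Fin (m + 1) → F, MvPolynomial.eval a f = 0 ∧
      MvPolynomial.eval a (MvPolynomial.pderiv (Fin.last m) f) ≠ 0 ∧
      MvPolynomial.eval (a ∘ Fin.castSucc) q ≠ 0 ∧
      ∀ i, a i - y i ∈ basicNhd χ F (u i)

open Ultrapower in
-- For a fixed number of variables and fixed degrees the property is a first-order sentence. Instead
-- of writing it down, the proof lifts all data to families and solves index by index.
theorem HasDenseZeros.ultrapower {L : FirstOrder.Language.{u, v}} {k : ℕ}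
    {χ : L.Formula (Fin 1 ⊕ Fin k)} {F : Type w} [Field F] [L.Structure F]
    (h : HasDenseZeros χ F) {I : Type w} (U : Ultrafilter I) :
    HasDenseZeros χ (Ultrapower U F) := by
  intro m f y u q hf hs hq
  obtain ⟨f, rfl⟩ := MvPolynomial.map_surjective _ (mkHom_surjective U F) f
  obtain ⟨q, rfl⟩ := MvPolynomial.map_surjective _ (mkHom_surjective U F) q
  choose y' hy' using fun i => mkHom_surjective U F (y i)
  choose u' hu' using fun i t => mkHom_surjective U F (u i t)
  obtain rfl : (fun i => mkHom U F (y' i)) = y := funext hy'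
  obtain rfl : (fun i t => mkHom U F (u' i t)) = u := funext fun i => funext (hu' i)
  rw [eval_map_mkHom, mkHom_eq_zero_iff] at hf
  rw [MvPolynomial.pderiv_map, eval_map_mkHom, mkHom_ne_zero_iff] at hs
  have hq' : ∀ᶠ i in U, MvPolynomial.map (Pi.evalRingHom (fun _ => F) i) q ≠ 0 := by
    obtain ⟨d, hd⟩ := MvPolynomial.ne_zero_iff.1 hq
    rw [MvPolynomial.coeff_map, mkHom_ne_zero_iff] at hd
    filter_upwards [hd] with i hi h0
    apply hi
    have := congrArg (MvPolynomial.coeff d) h0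
    rwa [MvPolynomial.coeff_map, MvPolynomial.coeff_zero] at this
  -- An implication, so that a point can be chosen at every index; where the hypotheses fail, it is
  -- the junk value `0`.
  have key : ∀ i, ∃ a : Fin (m + 1) → F,
      MvPolynomial.eval (fun j => y' j i) (MvPolynomial.map (Pi.evalRingHom (fun _ => F) i) f) = 0 →
      MvPolynomial.eval (fun j => y' j i) (MvPolynomial.map (Pi.evalRingHom (fun _ => F) i)
        (MvPolynomial.pderiv (Fin.last m) f)) ≠ 0 →
      MvPolynomial.map (Pi.evalRingHom (fun _ => F) i) q ≠ 0 →
      MvPolynomial.eval a (MvPolynomial.map (Pi.evalRingHom (fun _ => F) i) f) = 0 ∧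
      MvPolynomial.eval a (MvPolynomial.map (Pi.evalRingHom (fun _ => F) i)
        (MvPolynomial.pderiv (Fin.last m) f)) ≠ 0 ∧
      MvPolynomial.eval (a ∘ Fin.castSucc)
        (MvPolynomial.map (Pi.evalRingHom (fun _ => F) i) q) ≠ 0 ∧
      ∀ j, a j - y' j i ∈ basicNhd χ F (fun t => u' j t i) := by
    intro i
    by_cases hc :
      MvPolynomial.eval (fun j => y' j i) (MvPolynomial.map (Pi.evalRingHom (fun _ => F) i) f) = 0 ∧
      MvPolynomial.eval (fun j => y' j i) (MvPolynomial.map (Pi.evalRingHom (fun _ => F) i)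
        (MvPolynomial.pderiv (Fin.last m) f)) ≠ 0 ∧
      MvPolynomial.map (Pi.evalRingHom (fun _ => F) i) q ≠ 0
    · obtain ⟨h1, h2, h3⟩ := hc
      obtain ⟨a, ha⟩ := h m _ (fun j => y' j i) (fun j t => u' j t i) _ h1
        (by rwa [MvPolynomial.pderiv_map]) h3
      rw [MvPolynomial.pderiv_map] at ha
      exact ⟨a, fun _ _ _ => ha⟩
    · exact ⟨0, fun h1 h2 h3 => (hc ⟨h1, h2, h3⟩).elim⟩
  choose a ha using key
  refine ⟨fun j => mkHom U F (fun i => a i j), ?_, ?_, ?_, fun j => ?_⟩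
  · rw [eval_map_mkHom, mkHom_eq_zero_iff]
    filter_upwards [hf, hs, hq'] with i h1 h2 h3 using (ha i h1 h2 h3).1
  · rw [MvPolynomial.pderiv_map, eval_map_mkHom, mkHom_ne_zero_iff]
    filter_upwards [hf, hs, hq'] with i h1 h2 h3 using (ha i h1 h2 h3).2.1
  · rw [Function.comp_def, eval_map_mkHom, mkHom_ne_zero_iff]
    filter_upwards [hf, hs, hq'] with i h1 h2 h3 using (ha i h1 h2 h3).2.2.1
  · rw [← map_sub, mem_basicNhd_mkHom]
    filter_upwards [hf, hs, hq'] with i h1 h2 h3 using (ha i h1 h2 h3).2.2.2 j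

/-! ### Newton iteration and evaluation of polynomials. -/

/-- Newton iteration in an adically complete ring, for polynomials that need not be monic. -/
theorem IsAdicComplete.exists_root {R : Type*} [CommRing R] (I : Ideal R) [IsAdicComplete I R]
    (f : Polynomial R) (a₀ : R) (h₀ : f.eval a₀ ∈ I) (h₁ : IsUnit (f.derivative.eval a₀)) :
    ∃ a, f.eval a = 0 ∧ a - a₀ ∈ I := by
  let c : ℕ → R := fun n => Nat.rec a₀
    (fun _ b => b - f.eval b * Ring.inverse (f.derivative.eval b)) n
  have hc : ∀ n, c (n + 1) = c n - f.eval (c n) * Ring.inverse (f.derivative.eval (c n)) :=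
    fun n => rfl
  -- The derivative changes only modulo `I`, which lies in the Jacobson radical, so `Ring.inverse`
  -- is a true inverse along the iteration.
  have hunit : ∀ b, b - a₀ ∈ I → IsUnit (f.derivative.eval b) := by
    intro b hb
    obtain ⟨e, he⟩ := h₁
    have hmem : f.derivative.eval b - f.derivative.eval a₀ ∈ I :=
      I.mem_of_dvd (Polynomial.sub_dvd_eval_sub _ _ _) hb
    have hj := Ideal.mem_jacobson_bot.1 (IsAdicComplete.le_jacobson_bot I hmem) (↑e⁻¹ : R)
    have : f.derivative.eval b =
        ((f.derivative.eval b - f.derivative.eval a₀) * ↑e⁻¹ + 1) * e := by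
      rw [add_mul, mul_assoc, Units.inv_mul, he]; ring
    rw [this]
    exact hj.mul e.isUnit
  -- A gain of one power of `I` per step suffices; the Taylor remainder even lies in `I ^ (2(n+1))`.
  have hmain : ∀ n, c n - a₀ ∈ I ∧ f.eval (c n) ∈ I ^ (n + 1) := by
    intro n
    induction n with
    | zero => exact ⟨by simp [c], by simpa [c] using h₀⟩
    | succ n ih =>
      obtain ⟨ih1, ih2⟩ := ih
      have he : f.eval (c n) * Ring.inverse (f.derivative.eval (c n)) ∈ I ^ (n + 1) :=
        Ideal.mul_mem_right _ _ ih2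
      refine ⟨?_, ?_⟩
      · rw [hc, sub_right_comm]
        exact I.sub_mem ih1 (Ideal.pow_le_self n.succ_ne_zero he)
      · obtain ⟨r, hr⟩ := f.binomExpansion (c n)
          (-(f.eval (c n) * Ring.inverse (f.derivative.eval (c n))))
        rw [hc, sub_eq_add_neg, hr, mul_neg, mul_left_comm,
          Ring.mul_inverse_cancel _ (hunit _ ih1), mul_one, add_neg_cancel, zero_add, neg_sq]
        refine Ideal.mul_mem_left _ _ (Ideal.pow_le_pow_right ?_
          (pow_mul I (n + 1) 2 ▸ Ideal.pow_mem_pow he 2))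
        lia
  have hcauchy : ∀ {m n}, m ≤ n → c m ≡ c n [SMOD (I ^ m • ⊤ : Submodule R R)] := by
    intro m n hmn
    induction n, hmn using Nat.le_induction with
    | base => rfl
    | succ n hmn ih =>
      refine ih.trans ?_
      rw [SModEq.sub_mem, hc, sub_sub_cancel, Ideal.smul_eq_mul, Ideal.mul_top]
      exact Ideal.pow_le_pow_right (by lia) (Ideal.mul_mem_right _ _ (hmain n).2)
  obtain ⟨a, ha⟩ := IsPrecomplete.prec' (I := I) c hcauchy
  simp only [SModEq.sub_mem, Ideal.smul_eq_mul, Ideal.mul_top] at ha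
  refine ⟨a, ?_, ?_⟩
  · refine IsHausdorff.haus' (I := I) _ fun n => ?_
    rw [SModEq.zero, Ideal.smul_eq_mul, Ideal.mul_top]
    have h1 : f.eval (c n) - f.eval a ∈ I ^ n :=
      Ideal.mem_of_dvd _ (Polynomial.sub_dvd_eval_sub _ _ _) (ha n)
    have h2 : f.eval (c n) ∈ I ^ n := Ideal.pow_le_pow_right n.le_succ (hmain n).2
    simpa using Ideal.sub_mem _ h2 h1
  · have h1 := I.sub_mem (hmain 1).1 (by simpa using ha 1)
    simpa using h1

theorem MvPolynomial.eval₂Hom_sub_mem {R S τ : Type*} [CommRing R] [CommRing S] (φ : R →+* S)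
    (I : Ideal S) {a b : τ → S} (h : ∀ t, a t - b t ∈ I) (f : MvPolynomial τ R) :
    MvPolynomial.eval₂Hom φ a f - MvPolynomial.eval₂Hom φ b f ∈ I := by
  rw [← Ideal.Quotient.eq, MvPolynomial.map_eval₂Hom, MvPolynomial.map_eval₂Hom]
  congr 2
  funext t
  exact Ideal.Quotient.eq.2 (h t)

/-- Freezing all coordinates but the last reduces a system in several variables to one-variable
Newton iteration, with the last partial derivative as its derivative. -/
theorem MvPolynomial.eval₂Hom_snoc_eq_eval {R S : Type*} [CommRing R] [CommRing S] (φ : R →+* S)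
    {m : ℕ} (a : Fin m → S) (f : MvPolynomial (Fin (m + 1)) R) :
    ∃ p : Polynomial S,
      (∀ r, p.eval r = MvPolynomial.eval₂Hom φ (Fin.snoc a r) f) ∧
      ∀ r, p.derivative.eval r =
        MvPolynomial.eval₂Hom φ (Fin.snoc a r) (MvPolynomial.pderiv (Fin.last m) f) := by
  induction f using MvPolynomial.induction_on with
  | C c => exact ⟨Polynomial.C (φ c), fun r => by simp, fun r => by simp⟩
  | add f g hf hg =>
    obtain ⟨p, hp, hp'⟩ := hf
    obtain ⟨q, hq, hq'⟩ := hg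
    exact ⟨p + q, fun r => by rw [Polynomial.eval_add, hp, hq, map_add],
      fun r => by rw [Polynomial.derivative_add, Polynomial.eval_add, hp', hq', map_add, map_add]⟩
  | mul_X f i hf =>
    obtain ⟨p, hp, hp'⟩ := hf
    refine Fin.lastCases ?_ (fun i => ?_) i
    · refine ⟨p * Polynomial.X, fun r => ?_, fun r => ?_⟩
      · simp [hp]
      · simp [hp, hp', mul_comm, add_comm]
    · refine ⟨p * Polynomial.C (a i), fun r => ?_, fun r => ?_⟩
      · simp [hp]
      · have : MvPolynomial.pderiv (R := R) (Fin.last m) (MvPolynomial.X i.castSucc) = 0 :=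
          MvPolynomial.pderiv_X_of_ne (Fin.castSucc_lt_last i).ne
        simp [hp', this, mul_comm]

/-- The two ways to interpret names for the elements of `K` in an ultrapower of `K` agree. -/
theorem Ultrapower.structure_withConstants {L : FirstOrder.Language.{u, v}} {K : Type w}
    [L.Structure K] {I : Type w} (U : Ultrafilter I) :
    (Ultraproduct.structure : L[[K]].Structure (Ultrapower U K)) = L.withConstantsStructure K := by
  refine Structure.ext ?_ ?_
  · funext n f x
    rcases f with f | f <;> rfl
  · funext n f x
    rcases f with f | f <;> rfl

/-! ### Definable interiors, and density of zeros over c-large fields. -/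

section Interior

variable {L : FirstOrder.Language.{u, v}} (ι : FirstOrder.Language.ring →ᴸ L) {k : ℕ}
  (χ : L.Formula (Fin 1 ⊕ Fin k))

/-- The formula expressing that some translate `x + χ(·, v)` is contained in `χ(·, u)`. -/
noncomputable def interiorFormula : L.Formula (Fin 1 ⊕ Fin k) :=
  Formula.iExs (Fin k) (Formula.iAlls (Fin 1)
    ((χ.relabel (Sum.elim (fun _ => Sum.inr 0) (fun t => Sum.inl (Sum.inr t)))).imp
      (BoundedFormula.subst χ (Sum.elim
        (fun _ => Functions.apply₂ (ι.onFunction ringFunc.add)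
          (Term.var (Sum.inl (Sum.inl (Sum.inl 0)))) (Term.var (Sum.inr 0)))
        (fun t => Term.var (Sum.inl (Sum.inl (Sum.inr t))))) :
          L.Formula (((Fin 1 ⊕ Fin k) ⊕ Fin k) ⊕ Fin 1))))

variable {K : Type w} [Field K] [L.Structure K]

theorem realize_interiorFormula (hK : IsFieldExpansion ι K) (x : K) (u : Fin k → K) :
    (interiorFormula ι χ).Realize (Sum.elim ![x] u) ↔
      ∃ v : Fin k → K, ∀ z ∈ basicNhd χ K v, x + z ∈ basicNhd χ K u := by
  rw [interiorFormula, Formula.realize_iExs]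
  refine exists_congr fun v => ?_
  rw [Formula.realize_iAlls]
  have hz : (∀ z : Fin 1 → K, (fun z : K => (z ∈ basicNhd χ K v → x + z ∈ basicNhd χ K u)) (z 0)) ↔
      ∀ z ∈ basicNhd χ K v, x + z ∈ basicNhd χ K u :=
    ⟨fun h z => h ![z], fun h z => h (z 0)⟩
  rw [← hz]
  refine forall_congr' fun z => ?_
  rw [Formula.realize_imp, Formula.realize_relabel]
  refine imp_congr (iff_of_eq ?_) ?_
  · change _ = χ.Realize _
    congr 1
    funext b
    rcases b with b | b
    · fin_cases b; rfl
    · rfl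
  · rw [Formula.Realize, BoundedFormula.realize_subst]
    change _ ↔ χ.Realize _
    rw [Formula.Realize]
    refine iff_of_eq ?_
    congr 1
    funext b
    rcases b with b | b
    · fin_cases b
      simp [Term.realize_functions_apply₂, hK.add]
    · rfl

/-- Infinitesimals are tested only on definable open sets, whereas `χ(K, u)` is merely a
neighbourhood of `0`. Its interior is definable with parameters, since translates of the sets `χ(K,
v)` form neighbourhood bases. -/
theorem exists_formula_interior [TopologicalSpace K] [IsTopologicalRing K]
    (hK : IsFieldExpansion ι K) (hχ : IsNhdBasisFormula χ K) (u : Fin k → K) :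
    ∃ φ : L[[K]].Formula (Fin 1), ∀ x : K, φ.Realize ![x] ↔ x ∈ interior (basicNhd χ K u) := by
  refine ⟨BoundedFormula.subst ((L.lhomWithConstants K).onFormula (interiorFormula ι χ))
    (Sum.elim (fun i => Term.var i) (fun t => (L.con (u t)).term)), fun x => ?_⟩
  have h1 : x ∈ interior (basicNhd χ K u) ↔
      ∃ v : Fin k → K, ∀ z ∈ basicNhd χ K v, x + z ∈ basicNhd χ K u := by
    rw [mem_interior_iff_mem_nhds, ← map_add_left_nhds_zero, Filter.mem_map, hχ.mem_iff]
    simp [Set.subset_def]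
  rw [h1, ← realize_interiorFormula ι χ hK, Formula.Realize, BoundedFormula.realize_subst]
  rw [← LHom.realize_onFormula (L.lhomWithConstants K) (interiorFormula ι χ) (M := K),
    Formula.Realize]
  refine iff_of_eq ?_
  congr 1
  funext b
  rcases b with b | b
  · simp
  · rw [Sum.elim_inr, Sum.elim_inr, Term.realize_constants]
    rfl

end Interior

theorem IsCLarge.hasDenseZeros {L : FirstOrder.Language.{u, v}}
    {ι : FirstOrder.Language.ring →ᴸ L} {K : Type w} [Field K] [CharZero K] [L.Structure K]
    (hK : IsFieldExpansion ι K) [TopologicalSpace K] [IsTopologicalRing K]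
    {k : ℕ} {χ : L.Formula (Fin 1 ⊕ Fin k)} (hχ : IsNhdBasisFormula χ K)
    (hc : IsCLarge L K) : HasDenseZeros χ K := by
  intro m f y u q hf hs hq
  -- One power series variable suffices: a single line through `y` already leaves the set `q = 0`.
  obtain ⟨I, U, -, σ, hσC, hσ⟩ := hc.2 1
  set R := MvPowerSeries (Fin 1) K
  let τ : R →+* Ultrapower U K := σ.comp (algebraMap R (FractionRing R))
  have hτ : Function.Injective τ := σ.injective.comp (IsFractionRing.injective R (FractionRing R))
  have hτC : τ.comp MvPowerSeries.C = Ultrapower.diagHom U K := RingHom.ext hσC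
  let J : Ideal R := Ideal.span (Set.range MvPowerSeries.X)
  have hJ : J ≤ IsLocalRing.maximalIdeal R := by
    refine Ideal.span_le.2 ?_
    rintro _ ⟨i, rfl⟩
    rw [SetLike.mem_coe, IsLocalRing.mem_maximalIdeal, mem_nonunits_iff,
      MvPowerSeries.isUnit_iff_constantCoeff]
    simp
  -- a line through `y` along which `q` does not vanish identically
  obtain ⟨z, hz⟩ : ∃ z : Fin m → K, MvPolynomial.eval z q ≠ 0 := by
    by_contra! h
    exact hq (MvPolynomial.funext fun z => by rw [h z, map_zero])
  let l : Fin m → MvPolynomial (Fin 1) K := fun i =>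
    MvPolynomial.C (y i.castSucc) + MvPolynomial.C (z i - y i.castSucc) * MvPolynomial.X 0
  let a : Fin m → R := fun i => (l i : MvPowerSeries (Fin 1) K)
  have haJ : ∀ i, a i - MvPowerSeries.C (y i.castSucc) ∈ J := by
    intro i
    have : a i - MvPowerSeries.C (y i.castSucc) =
        MvPowerSeries.C (z i - y i.castSucc) * MvPowerSeries.X 0 := by
      rw [sub_eq_iff_eq_add, add_comm]
      change ((l i : MvPolynomial (Fin 1) K) : MvPowerSeries (Fin 1) K) = _
      rw [MvPolynomial.coe_add, MvPolynomial.coe_mul, MvPolynomial.coe_C, MvPolynomial.coe_C,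
        MvPolynomial.coe_X]
    rw [this]
    exact Ideal.mul_mem_left _ _ (Ideal.subset_span ⟨0, rfl⟩)
  -- Along the line `q` is a polynomial in `s`; at `s = 1` its value is `q(z) ≠ 0`.
  have hqa : MvPolynomial.eval₂Hom MvPowerSeries.C a q ≠ 0 := by
    have h1 : MvPolynomial.eval₂Hom MvPowerSeries.C a q =
        MvPolynomial.coeToMvPowerSeries.ringHom
          (MvPolynomial.eval₂Hom MvPolynomial.C l q) := by
      rw [MvPolynomial.map_eval₂Hom]
      congr 2
      ext1 c
      simp
    rw [h1]
    intro h0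
    have h2 : MvPolynomial.eval₂Hom MvPolynomial.C l q = 0 :=
      MvPolynomial.coe_injective _ _ (h0.trans MvPolynomial.coe_zero.symm)
    have h3 := congrArg (MvPolynomial.eval (fun _ => (1 : K))) h2
    rw [MvPolynomial.map_eval₂Hom, map_zero] at h3
    apply hz
    rw [← h3, MvPolynomial.eval]
    congr 2
    · ext1 c; simp
    · funext i; simp [l]
  -- Newton iteration gives the last coordinate
  have hconst : ∀ p : MvPolynomial (Fin (m + 1)) K,
      MvPolynomial.eval₂Hom (MvPowerSeries.C (σ := Fin 1))
        (fun i => MvPowerSeries.C (y i)) p = MvPowerSeries.C (MvPolynomial.eval y p) := by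
    intro p
    rw [MvPolynomial.eval, MvPolynomial.map_eval₂Hom, RingHom.comp_id]
  have hclose : ∀ r : R, r - MvPowerSeries.C (y (Fin.last m)) ∈ J →
      ∀ i, (Fin.snoc a r : Fin (m + 1) → R) i - MvPowerSeries.C (y i) ∈ J := by
    intro r hr i
    refine Fin.lastCases ?_ (fun i => ?_) i
    · simpa using hr
    · simpa using haJ i
  obtain ⟨p, hp, hp'⟩ := MvPolynomial.eval₂Hom_snoc_eq_eval
    (MvPowerSeries.C (σ := Fin 1) (R := K)) a f
  have hunit : ∀ r : R, r - MvPowerSeries.C (y (Fin.last m)) ∈ J →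
      IsUnit (p.derivative.eval r) := by
    intro r hr
    by_contra hnu
    have h1 : p.derivative.eval r ∈ IsLocalRing.maximalIdeal R := hnu
    have h2 := MvPolynomial.eval₂Hom_sub_mem (MvPowerSeries.C (σ := Fin 1)) J (hclose r hr)
      (MvPolynomial.pderiv (Fin.last m) f)
    rw [← hp', hconst] at h2
    have h3 := Ideal.sub_mem _ h1 (hJ h2)
    rw [sub_sub_cancel, IsLocalRing.mem_maximalIdeal, mem_nonunits_iff] at h3
    exact h3 ((IsUnit.mk0 _ hs).map MvPowerSeries.C)
  obtain ⟨r, hr0, hrJ⟩ := IsAdicComplete.exists_root J p (MvPowerSeries.C (y (Fin.last m)))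
    (by
      have h2 := MvPolynomial.eval₂Hom_sub_mem (MvPowerSeries.C (σ := Fin 1)) J
        (hclose (MvPowerSeries.C (y (Fin.last m))) (by simp)) f
      rwa [← hp, hconst, hf, map_zero, sub_zero] at h2)
    (hunit _ (by simp))
  -- transfer to the ultrapower and descend to `K`
  set b : Fin (m + 1) → R := Fin.snoc a r
  choose B hB using fun i => Ultrapower.mkHom_surjective U K (τ (b i))
  -- The reindexing `g` covers both `f`, in all coordinates, and `q`, in the first `m` only.
  have heval : ∀ {n : ℕ} (g : Fin n → Fin (m + 1)) (P : MvPolynomial (Fin n) K),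
      Ultrapower.mkHom U K (fun i => MvPolynomial.eval (fun j => B (g j) i) P) =
        τ (MvPolynomial.eval₂Hom MvPowerSeries.C (b ∘ g) P) := by
    intro n g P
    rw [← Ultrapower.eval_map_diagHom, MvPolynomial.map_eval₂Hom, hτC, MvPolynomial.eval_map]
    simp only [hB]
    rfl
  have e1 : ∀ᶠ i in U, MvPolynomial.eval (fun j => B j i) f = 0 := by
    rw [← Ultrapower.mkHom_eq_zero_iff (U := U), heval (fun j => j), show b ∘ (fun j => j) = b from rfl,
      ← hp, hr0, map_zero]
  have e2 : ∀ᶠ i in U,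
      MvPolynomial.eval (fun j => B j i) (MvPolynomial.pderiv (Fin.last m) f) ≠ 0 := by
    rw [← Ultrapower.mkHom_ne_zero_iff (U := U), heval (fun j => j), show b ∘ (fun j => j) = b from rfl,
      ← hp']
    exact ((hunit r hrJ).map τ).ne_zero
  have e3 : ∀ᶠ i in U, MvPolynomial.eval (fun j => B (Fin.castSucc j) i) q ≠ 0 := by
    rw [← Ultrapower.mkHom_ne_zero_iff (U := U), heval Fin.castSucc]
    have : b ∘ Fin.castSucc = a := by
      funext i; simp [b]
    rw [this]
    exact (map_ne_zero_iff τ hτ).2 hqa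
  have e4 : ∀ j, ∀ᶠ i in U, B j i - y j ∈ basicNhd χ K (u j) := by
    intro j
    obtain ⟨φ, hφ⟩ := exists_formula_interior ι χ hK hχ (u j)
    have h1 := hσ (b j - MvPowerSeries.C (y j)) (hJ (hclose r hrJ j)) φ
      (by simp only [hφ]; exact isOpen_interior)
      ((hφ 0).2 (mem_interior_iff_mem_nhds.2 (hχ.mem_of_mem trivial)))
    have h2 : σ (algebraMap R (FractionRing R) (b j - MvPowerSeries.C (y j))) =
        Ultrapower.mkHom U K (fun i => B j i - y j) := by
      change τ _ = _
      rw [map_sub, ← hB, ← RingHom.comp_apply, hτC, ← Ultrapower.mkHom_const, ← map_sub]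
      rfl
    -- Infinitesimality is read in the structure with constants, Łoś's theorem in the ultraproduct
    -- of `L[[K]]`-structures.
    rw [h2, ← Ultrapower.structure_withConstants] at h1
    have h3 := (Ultrapower.realize_mkHom (U := U) φ (fun _ i => B j i - y j)).1 (by
      convert h1 using 2 with t
      fin_cases t; rfl)
    filter_upwards [h3] with i hi
    refine interior_subset ((hφ _).1 ?_)
    convert hi using 1
    funext t; fin_cases t; rfl
  obtain ⟨i, h1, h2, h3, h4⟩ :=
    (e1.and (e2.and (e3.and (Filter.eventually_all.2 e4)))).exists
  exact ⟨fun j => B j i, h1, h2, h3, h4⟩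

/-! ### Extension of derivations in characteristic zero. -/

/-- Over a transcendence basis the extension is algebraic, hence separable in characteristic zero.
-/
theorem Algebra.FormallySmooth.of_charZero (F E : Type*) [Field F] [Field E] [Algebra F E]
    [CharZero F] : Algebra.FormallySmooth F E := by
  obtain ⟨s, hs⟩ := exists_isTranscendenceBasis F E
  have := hs.isAlgebraic_field
  exact .of_algebraicIndependent_of_isSeparable hs.1

open scoped IntermediateField.algebraAdjoinAdjoin in
-- Factor through the field `F(s)`: a localization of `F[s]`, followed by a field extension in
-- characteristic zero.
theorem Algebra.FormallySmooth.adjoin_of_charZero {F E : Type*} [Field F] [Field E]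
    [Algebra F E] [CharZero F] (s : Set E) :
    Algebra.FormallySmooth (Algebra.adjoin F s) E := by
  have : Algebra.FormallySmooth (Algebra.adjoin F s) (IntermediateField.adjoin F s) :=
    .of_isLocalization (nonZeroDivisors _)
  have := Algebra.FormallySmooth.of_charZero (IntermediateField.adjoin F s) E
  exact .comp _ (IntermediateField.adjoin F s) _

theorem Algebra.FormallySmooth.exists_ringHom_lift {A E D : Type*} [CommRing A] [CommRing E]
    [CommRing D] [Algebra A E] [Algebra.FormallySmooth A E] (g : A →+* D) (p : D →+* E)
    (hp : Function.Surjective p) (hker : IsNilpotent (RingHom.ker p))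
    (hg : p.comp g = algebraMap A E) :
    ∃ h : E →+* D, p.comp h = RingHom.id E ∧ h.comp (algebraMap A E) = g := by
  let := g.toAlgebra
  let p' : D →ₐ[A] E := { p with commutes' := fun a => RingHom.congr_fun hg a }
  let l := Algebra.FormallySmooth.liftOfSurjective (AlgHom.id A E) p' hp hker
  refine ⟨l, RingHom.ext fun e => ?_, RingHom.ext fun a => ?_⟩
  · exact Algebra.FormallySmooth.liftOfSurjective_apply (AlgHom.id A E) p' hp hker e
  · exact l.commutes a

/-- In characteristic zero, a derivation extends to any extension field, with prescribed values on
algebraically independent elements. -/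
theorem AlgebraicIndependent.exists_derivation {F E ι : Type*} [Field F] [Field E]
    [Algebra F E] [CharZero F] {x : ι → E} (hx : AlgebraicIndependent F x) (t : ι → E)
    (δ : Derivation ℤ F F) :
    ∃ D : Derivation ℤ E E, (∀ a, D (algebraMap F E a) = algebraMap F E (δ a)) ∧
      ∀ i, D (x i) = t i := by
  -- A derivation is the same as a ring homomorphism `a ↦ a + δ(a)ε` into the dual numbers;
  -- extending the one extends the other.
  let c : F →+* DualNumber E :=
    { toFun := fun a => TrivSqZeroExt.inl (algebraMap F E a) +
        TrivSqZeroExt.inr (algebraMap F E (δ a))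
      map_one' := by ext <;> simp
      map_zero' := by ext <;> simp
      map_add' := fun a b => by ext <;> simp only [map_add, TrivSqZeroExt.fst_add, TrivSqZeroExt.snd_add,
          TrivSqZeroExt.fst_inl, TrivSqZeroExt.fst_inr, TrivSqZeroExt.snd_inl, TrivSqZeroExt.snd_inr,
          zero_add, add_zero]
      map_mul' := fun a b => by
        ext
        · simp
        · simp only [Derivation.leibniz, smul_eq_mul, map_add, map_mul, TrivSqZeroExt.snd_add,
            TrivSqZeroExt.snd_inl, TrivSqZeroExt.snd_inr, TrivSqZeroExt.snd_mul,
            TrivSqZeroExt.fst_add, TrivSqZeroExt.fst_inl, TrivSqZeroExt.fst_inr,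
            op_smul_eq_mul, zero_add, add_zero]
          ring }
  let g : MvPolynomial ι F →+* DualNumber E := MvPolynomial.eval₂Hom c
    fun i => TrivSqZeroExt.inl (x i) + TrivSqZeroExt.inr (t i)
  let p : DualNumber E →+* E := (TrivSqZeroExt.fstHom E E E).toRingHom
  have hp : Function.Surjective p := fun e => ⟨TrivSqZeroExt.inl e, TrivSqZeroExt.fst_inl E e⟩
  have hker : IsNilpotent (RingHom.ker p) := by
    refine ⟨2, ?_⟩
    rw [Ideal.zero_eq_bot, eq_bot_iff, show RingHom.ker p ^ 2 = _ from sq _, Ideal.mul_le]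
    intro r hr s hs
    have hr : r.fst = 0 := hr
    have hs : s.fst = 0 := hs
    rw [Ideal.mem_bot]
    ext <;> simp [hr, hs]
  have hpg : p.comp g = (MvPolynomial.aeval (R := F) x).toRingHom := by
    refine MvPolynomial.ringHom_ext (fun a => ?_) (fun i => ?_) <;> simp [p, g, c]
  have := Algebra.FormallySmooth.adjoin_of_charZero (F := F) (Set.range x)
  -- By independence `F[x]` is a polynomial ring, so `g` is defined on it; smoothness of `E` over
  -- `F[x]` extends it to a section of `p` on `E`.
  obtain ⟨h, hh, hA⟩ := Algebra.FormallySmooth.exists_ringHom_lift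
    (A := Algebra.adjoin F (Set.range x))
    (g.comp hx.aevalEquiv.symm.toRingEquiv.toRingHom) p hp hker (by
      rw [← RingHom.comp_assoc, hpg]
      refine RingHom.ext fun a => ?_
      obtain ⟨q, rfl⟩ := hx.aevalEquiv.surjective a
      simp)
  have hfst : ∀ e, (h e).fst = e := fun e => RingHom.congr_fun hh e
  have hval : ∀ q : MvPolynomial ι F, h (MvPolynomial.aeval x q) = g q := fun q => by
    have := RingHom.congr_fun hA (hx.aevalEquiv q)
    simpa using this
  let D : Derivation ℤ E E := Derivation.mk'
    (AddMonoidHom.toIntLinearMap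
      { toFun := fun e => (h e).snd
        map_zero' := by simp
        map_add' := fun a b => by simp }) (fun a b => by simp [hfst, mul_comm])
  refine ⟨D, fun a => ?_, fun i => ?_⟩
  · have := hval (MvPolynomial.C a)
    simp only [MvPolynomial.aeval_C] at this
    change (h _).snd = _
    rw [this]
    simp only [g, MvPolynomial.coe_eval₂Hom, MvPolynomial.eval₂_C]
    change (TrivSqZeroExt.inl _ + TrivSqZeroExt.inr _ : DualNumber E).snd = _
    rw [TrivSqZeroExt.snd_add, TrivSqZeroExt.snd_inl, TrivSqZeroExt.snd_inr, zero_add]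
  · have := hval (MvPolynomial.X i)
    simp only [MvPolynomial.aeval_X] at this
    change (h _).snd = _
    simp [this, g]

/-- `AlgebraicIndependent.exists_derivation` along a ring homomorphism. -/
theorem exists_derivation_extending {F E ι : Type*} [Field F] [Field E] [CharZero F]
    (φ : F →+* E) {x : ι → E}
    (hx : ∀ q : MvPolynomial ι F, q ≠ 0 → MvPolynomial.eval x (MvPolynomial.map φ q) ≠ 0)
    (t : ι → E) (δ : Derivation ℤ F F) :
    ∃ D : Derivation ℤ E E, (∀ a, D (φ a) = φ (δ a)) ∧ ∀ i, D (x i) = t i := by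
  let := φ.toAlgebra
  have hx' : AlgebraicIndependent F x := by
    refine (injective_iff_map_eq_zero _).2 fun q hq => ?_
    by_contra h0
    refine hx q h0 ?_
    rwa [MvPolynomial.eval_map]
  exact hx'.exists_derivation t δ

/-! ### Generic solutions in an ultrapower. -/

/-- A product of Zariski dense sets is Zariski dense. -/
theorem MvPolynomial.exists_mem_pi_eval_ne_zero {F : Type*} [Field F] [Infinite F] {J : Type*}
    {V : J → Type*} (S : ∀ j, Set (V j → F))
    (hS : ∀ j (q : MvPolynomial (V j) F), q ≠ 0 → ∃ s ∈ S j, MvPolynomial.eval s q ≠ 0)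
    (q : MvPolynomial (Σ j, V j) F) (hq : q ≠ 0) :
    ∃ a : ∀ j, V j → F, (∀ j, a j ∈ S j) ∧
      MvPolynomial.eval (fun p : Σ j, V j => a p.1 p.2) q ≠ 0 := by
  classical
  -- Starting from any point with `q ≠ 0`, move one block of coordinates at a time into its set `S
  -- j`.
  have key : ∀ T : Finset J, ∃ a : ∀ j, V j → F, (∀ j ∈ T, a j ∈ S j) ∧
      MvPolynomial.eval (fun p : Σ j, V j => a p.1 p.2) q ≠ 0 := by
    intro T
    induction T using Finset.induction_on with
    | empty =>
      by_contra! h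
      refine hq (MvPolynomial.funext fun z => ?_)
      rw [map_zero]
      exact h (fun j v => z ⟨j, v⟩) (by simp)
    | insert j T hj ih =>
      obtain ⟨b, hbT, hb⟩ := ih
      let q' : MvPolynomial (V j) F := MvPolynomial.eval₂Hom MvPolynomial.C
        (fun p : Σ j, V j => Function.update (fun i v => MvPolynomial.C (b i v)) j
          MvPolynomial.X p.1 p.2) q
      have hq' : ∀ s : V j → F, MvPolynomial.eval s q' =
          MvPolynomial.eval (fun p : Σ j, V j => Function.update b j s p.1 p.2) q := by
        intro s
        rw [MvPolynomial.map_eval₂Hom]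
        conv_rhs => rw [MvPolynomial.eval]
        congr 2
        · ext1 c; simp
        · funext ⟨i, v⟩
          by_cases h : i = j
          · subst h; simp
          · simp [Function.update_of_ne h]
      obtain ⟨s, hs, hsq⟩ := hS j q' (by
        intro h0
        have := hq' (b j)
        rw [h0, map_zero, Function.update_eq_self] at this
        exact hb this.symm)
      refine ⟨Function.update b j s, fun i hi => ?_, by rwa [hq'] at hsq⟩
      by_cases h : i = j
      · subst h; simpa using hs
      · rw [Function.update_of_ne h]
        exact hbT i (Finset.mem_of_mem_insert_of_ne hi h)
  -- Blocks not occurring in `q` are filled with arbitrary elements of `S j`, which is nonempty by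
  -- the density hypothesis for `1`.
  choose c hc using fun j => hS j 1 one_ne_zero
  obtain ⟨a, haT, ha⟩ := key (q.vars.image Sigma.fst)
  refine ⟨fun j => if j ∈ q.vars.image Sigma.fst then a j else c j, fun j => ?_, ?_⟩
  · by_cases h : j ∈ q.vars.image Sigma.fst
    · simpa only [if_pos h] using haT j h
    · simpa only [if_neg h] using (hc j).1
  · convert ha using 1
    refine MvPolynomial.eval₂Hom_congr' rfl (fun p hp _ => ?_) rfl
    simp only [if_pos (Finset.mem_image_of_mem Sigma.fst hp)]

/-- Some ultrafilter on the nonzero elements of a domain contains, for each of them, the set of its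
multiples. -/
theorem exists_ultrafilter_dvd (R : Type*) [CommRing R] [IsDomain R] :
    ∃ U : Ultrafilter {q : R // q ≠ 0},
      ∀ q : R, q ≠ 0 → ∀ᶠ p : {q : R // q ≠ 0} in U, q ∣ p.1 := by
  let B : {q : R // q ≠ 0} → Filter {q : R // q ≠ 0} :=
    fun q => Filter.principal {p | q.1 ∣ p.1}
  have : Nonempty {q : R // q ≠ 0} := ⟨⟨1, one_ne_zero⟩⟩
  have : (⨅ q, B q).NeBot := by
    refine Filter.iInf_neBot_of_directed' ?_ fun q => ?_
    · intro q r
      refine ⟨⟨q.1 * r.1, mul_ne_zero q.2 r.2⟩, ?_, ?_⟩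
      · exact Filter.principal_mono.2 fun p hp => (dvd_mul_right _ _).trans hp
      · exact Filter.principal_mono.2 fun p hp => (dvd_mul_left _ _).trans hp
    · exact Filter.principal_neBot_iff.2 ⟨q, dvd_rfl⟩
  refine ⟨Ultrafilter.of (⨅ q, B q), fun q hq => ?_⟩
  exact Ultrafilter.of_le _ (Filter.mem_iInf_of_mem ⟨q, hq⟩ (Filter.mem_principal_self _))

open Ultrapower in
/-- A derivation extends to some ultrapower in such a way that all systems over the base field
covered by the scheme (DL) are solved there. -/
theorem HasDenseZeros.exists_ultrapower_derivation {L : FirstOrder.Language.{u, v}} {k : ℕ}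
    {χ : L.Formula (Fin 1 ⊕ Fin k)} {F : Type w} [Field F] [CharZero F] [L.Structure F]
    (h : HasDenseZeros χ F) (δ : Derivation ℤ F F) :
    ∃ (I : Type w) (U : Ultrafilter I) (D : Derivation ℤ (Ultrapower U F) (Ultrapower U F)),
      (∀ a, D (diagHom U F a) = diagHom U F (δ a)) ∧
      ∀ (m : ℕ) (f : MvPolynomial (Fin (m + 1)) F) (y : Fin (m + 1) → F)
        (u : Fin (m + 1) → Fin k → F), MvPolynomial.eval y f = 0 →
        MvPolynomial.eval y (MvPolynomial.pderiv (Fin.last m) f) ≠ 0 →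
        ∃ x : Ultrapower U F,
          MvPolynomial.eval (fun i : Fin (m + 1) => D^[i] x)
            (MvPolynomial.map (diagHom U F) f) = 0 ∧
          MvPolynomial.eval (fun i : Fin (m + 1) => D^[i] x)
            (MvPolynomial.map (diagHom U F) (MvPolynomial.pderiv (Fin.last m) f)) ≠ 0 ∧
          ∀ i : Fin (m + 1), D^[i] x - diagHom U F (y i) ∈
            basicNhd χ (Ultrapower U F) (fun t => diagHom U F (u i t)) := by
  -- All systems over `F` are treated simultaneously, since one derivation must serve them all.
  let J : Type w := {j : Σ m : ℕ, MvPolynomial (Fin (m + 1)) F × (Fin (m + 1) → F) ×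
    (Fin (m + 1) → Fin k → F) // MvPolynomial.eval j.2.2.1 j.2.1 = 0 ∧
      MvPolynomial.eval j.2.2.1 (MvPolynomial.pderiv (Fin.last j.1) j.2.1) ≠ 0}
  let IsSol : ∀ j : J, (Fin (j.1.1 + 1) → F) → Prop := fun j a =>
    MvPolynomial.eval a j.1.2.1 = 0 ∧
    MvPolynomial.eval a (MvPolynomial.pderiv (Fin.last j.1.1) j.1.2.1) ≠ 0 ∧
    ∀ i, a i - j.1.2.2.1 i ∈ basicNhd χ F (j.1.2.2.2 i)
  have hsol : ∀ q : MvPolynomial (Σ j : J, Fin j.1.1) F, q ≠ 0 →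
      ∃ a : ∀ j : J, Fin (j.1.1 + 1) → F, (∀ j, IsSol j (a j)) ∧
        MvPolynomial.eval (fun p : Σ j : J, Fin j.1.1 => a p.1 p.2.castSucc) q ≠ 0 := by
    intro q hq
    obtain ⟨a, ha, haq⟩ := MvPolynomial.exists_mem_pi_eval_ne_zero
      (V := fun j : J => Fin j.1.1)
      (fun j => {s | ∃ a, IsSol j a ∧ a ∘ Fin.castSucc = s}) (by
        intro j q hq
        obtain ⟨a, h1, h2, h3, h4⟩ := h j.1.1 j.1.2.1 j.1.2.2.1 j.1.2.2.2 q j.2.1 j.2.2 hq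
        exact ⟨_, ⟨a, ⟨h1, h2, h4⟩, rfl⟩, h3⟩) q hq
    choose b hb hba using ha
    refine ⟨b, hb, ?_⟩
    convert haq using 4 with p
    exact congrFun (hba p.1) p.2
  obtain ⟨U, hU⟩ := exists_ultrafilter_dvd (MvPolynomial (Σ j : J, Fin j.1.1) F)
  choose a ha haq using fun q : {q : MvPolynomial (Σ j : J, Fin j.1.1) F // q ≠ 0} => hsol q.1 q.2
  let A : ∀ j : J, Fin (j.1.1 + 1) → Ultrapower U F := fun j i => mkHom U F (fun q => a q j i)
  -- `D` is prescribed on coordinates `0, …, m-1` only. The last coordinate may be algebraic over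
  -- them, but it is needed only as a value of `D`.
  obtain ⟨D, hD, hDA⟩ := exists_derivation_extending (diagHom U F)
    (x := fun p : Σ j : J, Fin j.1.1 => A p.1 p.2.castSucc) (by
      intro q hq
      rw [eval_map_diagHom, mkHom_ne_zero_iff]
      -- The point at index `p` is not a zero of `p`, so it is not a zero of any divisor `q` of `p`.
      filter_upwards [hU q hq] with p hp h0
      obtain ⟨r, hr⟩ := hp
      apply haq p
      rw [hr, map_mul, h0, zero_mul]) (fun p => A p.1 p.2.succ) δ
  refine ⟨_, U, D, hD, fun m f y u hf hs => ?_⟩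
  let j : J := ⟨⟨m, f, y, u⟩, hf, hs⟩
  have hiter : ∀ i : Fin (m + 1), D^[i] (A j 0) = A j i := by
    intro i
    induction i using Fin.induction with
    | zero => rfl
    | succ i ih =>
      rw [Fin.val_succ, Function.iterate_succ_apply']
      rw [Fin.val_castSucc] at ih
      rw [ih]
      exact hDA ⟨j, i⟩
  refine ⟨A j 0, ?_, ?_, fun i => ?_⟩
  · simp only [hiter]
    rw [eval_map_diagHom, mkHom_eq_zero_iff]
    exact Filter.Eventually.of_forall fun q => (ha q j).1
  · simp only [hiter]
    rw [eval_map_diagHom, mkHom_ne_zero_iff]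
    exact Filter.Eventually.of_forall fun q => (ha q j).2.1
  · rw [hiter, ← mkHom_const, ← map_sub]
    exact (mem_basicNhd_mkHom χ _ (fun t _ => u i t)).2
      (Filter.Eventually.of_forall fun q => (ha q j).2.2 i)

/-! ### From differential polynomials to ordinary ones. -/

namespace DiffPoly

variable {K : Type w} [Field K]

theorem pderiv_star (m : ℕ) (P : DiffPoly K) :
    MvPolynomial.pderiv (Fin.last m) (P.star m) = (P.separant m).star m := by
  simp only [star, separant]
  induction P using MvPolynomial.induction_on with
  | C a => simp
  | add p q hp hq => simp only [map_add, hp, hq]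
  | mul_X p i hp =>
    simp only [map_mul, Derivation.leibniz, smul_eq_mul, map_add, hp, MvPolynomial.aeval_X]
    congr 2
    by_cases hi : i = m
    · subst hi
      have : (⟨i, i.lt_succ_self⟩ : Fin (i + 1)) = Fin.last i := rfl
      simp [this]
    · rw [MvPolynomial.pderiv_X_of_ne hi, map_zero]
      split_ifs with h
      · exact MvPolynomial.pderiv_X_of_ne fun h' => hi (congrArg Fin.val h')
      · exact map_zero _

theorem eval_star {m : ℕ} {P : DiffPoly K} (hP : ∀ i ∈ P.vars, i ≤ m) (z : ℕ → K) :
    MvPolynomial.eval (fun i : Fin (m + 1) => z i) (P.star m) = MvPolynomial.eval z P := by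
  rw [star, ← MvPolynomial.coe_aeval_eq_eval, RingHom.coe_coe, ← AlgHom.comp_apply,
    MvPolynomial.comp_aeval]
  refine MvPolynomial.eval₂Hom_congr' rfl (fun i hi _ => ?_) rfl
  simp [Nat.lt_succ_of_le (hP i hi)]

theorem vars_separant_subset (m : ℕ) (P : DiffPoly K) : (P.separant m).vars ⊆ P.vars := by
  have hP : P ∈ MvPolynomial.supported K (P.vars : Set ℕ) := MvPolynomial.mem_supported_vars P
  suffices h : MvPolynomial.pderiv m P ∈ MvPolynomial.supported K (P.vars : Set ℕ) by
    exact_mod_cast MvPolynomial.mem_supported.1 h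
  generalize (P.vars : Set ℕ) = s at hP
  refine Algebra.adjoin_induction ?_ ?_ ?_ ?_ hP
  · rintro _ ⟨i, -, rfl⟩
    rw [MvPolynomial.pderiv_X, Pi.single_apply]
    split_ifs
    · exact one_mem _
    · exact zero_mem _
  · intro r
    rw [Derivation.map_algebraMap]
    exact zero_mem _
  · intro p q _ _ hp hq
    rw [map_add]
    exact add_mem hp hq
  · intro p q hp hq hp' hq'
    rw [Derivation.leibniz]
    exact add_mem (mul_mem hp hq') (mul_mem hq hp')

end DiffPoly

/-- Evaluating `P^*` on a jet gives `P(x)` because the order bounds the variables of `P` and of its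
separant. This leaves a condition on ordinary polynomials, which is easier to carry along a chain.
-/
theorem modelsDL_of_forall {L : FirstOrder.Language.{u, v}} {k : ℕ}
    {χ : L.Formula (Fin 1 ⊕ Fin k)} {K : Type w} [Field K] [L.Structure K] {δ : Derivation ℤ K K}
    (h : ∀ (m : ℕ) (f : MvPolynomial (Fin (m + 1)) K) (y : Fin (m + 1) → K)
        (u : Fin (m + 1) → Fin k → K), MvPolynomial.eval y f = 0 →
        MvPolynomial.eval y (MvPolynomial.pderiv (Fin.last m) f) ≠ 0 →
        ∃ x : K, MvPolynomial.eval (fun i : Fin (m + 1) => δ^[i] x) f = 0 ∧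
          MvPolynomial.eval (fun i : Fin (m + 1) => δ^[i] x)
            (MvPolynomial.pderiv (Fin.last m) f) ≠ 0 ∧
          ∀ i : Fin (m + 1), δ^[i] x - y i ∈ basicNhd χ K (u i)) :
    ModelsDL χ δ := by
  intro m P hP u y hy hs
  obtain ⟨x, h1, h2, h3⟩ := h m (P.star m) y u hy (by rwa [DiffPoly.pderiv_star])
  rw [DiffPoly.pderiv_star] at h2
  refine ⟨x, ?_, ?_, h3⟩
  · rwa [DiffPoly.eval_star hP.2 (fun i => δ^[i] x)] at h1
  · rwa [DiffPoly.eval_star (fun i hi => hP.2 i (P.vars_separant_subset m hi))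
      (fun i => δ^[i] x)] at h2

/-! ### Unions of elementary chains. -/

/-- **Tarski's elementary chain theorem**: the components of a directed system of elementary
embeddings are elementarily embedded in the direct limit. -/
theorem FirstOrder.Language.DirectLimit.realize_of {L : FirstOrder.Language.{u, v}} {A : Type*}
    [Preorder A] [IsDirectedOrder A] [Nonempty A] {G : A → Type w} [∀ i, L.Structure (G i)]
    {f : ∀ i j, i ≤ j → G i ↪[L] G j} [DirectedSystem G fun i j h => f i j h]
    (hf : ∀ i j (h : i ≤ j) {β : Type} {n : ℕ} (φ : L.BoundedFormula β n) (v : β → G i)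
      (xs : Fin n → G i), φ.Realize (f i j h ∘ v) (f i j h ∘ xs) ↔ φ.Realize v xs)
    {β : Type} {n : ℕ} (φ : L.BoundedFormula β n) (i : A) (v : β → G i) (xs : Fin n → G i) :
    φ.Realize (DirectLimit.of L A G f i ∘ v) (DirectLimit.of L A G f i ∘ xs) ↔
      φ.Realize v xs := by
  induction φ generalizing i with
  | falsum => rfl
  | equal t₁ t₂ =>
    simp only [BoundedFormula.Realize, ← Sum.comp_elim, HomClass.realize_term,
      (DirectLimit.of L A G f i).injective.eq_iff]
  | rel R ts =>
    simp only [BoundedFormula.Realize, ← Sum.comp_elim, HomClass.realize_term]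
    exact (DirectLimit.of L A G f i).map_rel R _
  | imp _ _ ih₁ ih₂ => simp only [BoundedFormula.Realize, ih₁, ih₂]
  | all φ ih =>
    simp only [BoundedFormula.Realize]
    refine ⟨fun h x => ?_, fun h z => ?_⟩
    · rw [← ih, Fin.comp_snoc]
      exact h _
    -- The element `z` appears at a stage `j`; at a common later stage `l` the universal formula
    -- still holds, because `G i → G l` is elementary.
    · obtain ⟨j, z, rfl⟩ := DirectLimit.exists_of z
      obtain ⟨l, hil, hjl⟩ := directed_of (· ≤ ·) i j
      have hv : DirectLimit.of L A G f i ∘ v = DirectLimit.of L A G f l ∘ (f i l hil ∘ v) := by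
        funext b; exact DirectLimit.of_f.symm
      have hxs : DirectLimit.of L A G f i ∘ xs =
          DirectLimit.of L A G f l ∘ (f i l hil ∘ xs) := by
        funext b; exact DirectLimit.of_f.symm
      rw [hv, hxs, ← DirectLimit.of_f (hij := hjl), ← Fin.comp_snoc, ih]
      exact (hf i l hil (BoundedFormula.all φ) v xs).2 h (f j l hjl z)

/-- The ring homomorphism underlying an embedding of expansions of fields. -/
def IsFieldExpansion.ringHom {L : FirstOrder.Language.{u, v}}
    {ι : FirstOrder.Language.ring →ᴸ L} {M N : Type*} [Field M] [Field N] [L.Structure M]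
    [L.Structure N] (hM : IsFieldExpansion ι M) (hN : IsFieldExpansion ι N) (e : M ↪[L] N) :
    M →+* N where
  toFun := e
  map_one' := by
    rw [← hM.one, e.map_fun, ← hN.one]
    congr 1; funext i; exact i.elim0
  map_zero' := by
    rw [← hM.zero, e.map_fun, ← hN.zero]
    congr 1; funext i; exact i.elim0
  map_add' x y := by
    rw [← hM.add, e.map_fun, ← hN.add]
    congr 1; funext i; fin_cases i <;> rfl
  map_mul' x y := by
    rw [← hM.mul, e.map_fun, ← hN.mul]
    congr 1; funext i; fin_cases i <;> rfl

/-- A structure elementarily equivalent to an expansion of a field expands a field. -/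
theorem IsFieldExpansion.exists_field {L : FirstOrder.Language.{u, v}}
    {ι : FirstOrder.Language.ring →ᴸ L} {M N : Type*} [Field M] [L.Structure M]
    [L.Structure N] (hM : IsFieldExpansion ι M) (e : L.ElementarilyEquivalent M N) :
    ∃ _ : Field N, IsFieldExpansion ι N := by
  -- The field axioms, translated by `ι`, are part of the `L`-theory.
  have hmodel : (ι.onTheory Theory.field).Model M := by
    let : Ring.CompatibleRing M :=
      { ι.reduct M with
        funMap_add := fun x => (hM.add (x 0) (x 1)).symm ▸
          congrArg (Structure.funMap (ι.onFunction ringFunc.add))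
            (funext fun i => by fin_cases i <;> rfl)
        funMap_mul := fun x => (hM.mul (x 0) (x 1)).symm ▸
          congrArg (Structure.funMap (ι.onFunction ringFunc.mul))
            (funext fun i => by fin_cases i <;> rfl)
        funMap_neg := fun x => (hM.neg (x 0)).symm ▸
          congrArg (Structure.funMap (ι.onFunction ringFunc.neg))
            (funext fun i => by fin_cases i; rfl)
        funMap_zero := fun x => hM.zero ▸
          congrArg (Structure.funMap (ι.onFunction ringFunc.zero)) (funext fun i => i.elim0)
        funMap_one := fun x => hM.one ▸
          congrArg (Structure.funMap (ι.onFunction ringFunc.one)) (funext fun i => i.elim0) }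
    exact (@LHom.onTheory_model _ _ M (ι.reduct M) _ ι _ Theory.field).2 inferInstance
  have hN : (ι.onTheory Theory.field).Model N := e.theory_model_iff.1 hmodel
  let := ι.reduct N
  have : Theory.field.Model N := (LHom.onTheory_model ι Theory.field).1 hN
  exact ⟨Field.fieldOfModelField N,
    let := Field.fieldOfModelField N
    { add := fun _ _ => rfl
      mul := fun _ _ => rfl
      neg := fun _ => rfl
      zero := congrArg (Structure.funMap (ι.onFunction ringFunc.zero)) (Subsingleton.elim _ _)
      one := congrArg (Structure.funMap (ι.onFunction ringFunc.one)) (Subsingleton.elim _ _) }⟩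

/-- The union of an elementary chain of expansions of differential fields. -/
theorem exists_limit_of_elementary_chain {L : FirstOrder.Language.{u, v}}
    {ι : FirstOrder.Language.ring →ᴸ L} (G : ℕ → Type w) [∀ n, Field (G n)]
    [∀ n, L.Structure (G n)] (hG : ∀ n, IsFieldExpansion ι (G n))
    (D : ∀ n, Derivation ℤ (G n) (G n)) (e : ∀ n, G n ↪ₑ[L] G (n + 1))
    (he : ∀ n x, e n (D n x) = D (n + 1) (e n x)) :
    ∃ (K' : Type w) (_ : Field K') (_ : L.Structure K') (D' : Derivation ℤ K' K')
      (j : ∀ n, G n ↪ₑ[L] K'),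
      IsFieldExpansion ι K' ∧ (∀ n x, j (n + 1) (e n x) = j n x) ∧
      (∀ n x, j n (D n x) = D' (j n x)) ∧ ∀ z, ∃ n x, j n x = z := by
  let f := DirectedSystem.natLERec (L := L) fun n => (e n).toEmbedding
  have hself : ∀ i, f i i le_rfl = Embedding.refl L (G i) := fun i => Nat.leRecOn_self _
  have hsucc : ∀ i j (h : i ≤ j), f i (j + 1) (h.trans j.le_succ) =
      (e j).toEmbedding.comp (f i j h) := fun i j h => Nat.leRecOn_succ h _
  have hf : ∀ i j (h : i ≤ j) {β : Type} {n : ℕ} (φ : L.BoundedFormula β n) (v : β → G i)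
      (xs : Fin n → G i), φ.Realize (f i j h ∘ v) (f i j h ∘ xs) ↔ φ.Realize v xs := by
    intro i j h β n φ v xs
    induction j, h using Nat.le_induction with
    | base => rw [hself]; rfl
    | succ j h ih =>
      rw [hsucc i j h, ← ih]
      exact (e j).map_boundedFormula φ (f i j h ∘ v) (f i j h ∘ xs)
  have hfD : ∀ i j (h : i ≤ j) (x : G i), f i j h (D i x) = D j (f i j h x) := by
    intro i j h x
    induction j, h using Nat.le_induction with
    | base => rw [hself]; rfl
    | succ j h ih =>
      rw [hsucc i j h, Embedding.comp_apply, Embedding.comp_apply, ih]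
      exact he j _
  let K' : Type w := Language.DirectLimit G f
  let j : ∀ n, G n ↪ₑ[L] K' := fun n =>
    { toFun := DirectLimit.of L ℕ G f n
      map_formula' := fun m φ x => by
        have := DirectLimit.realize_of hf φ n x default
        rwa [Unique.eq_default (DirectLimit.of L ℕ G f n ∘ default)] at this }
  obtain ⟨_, hK'⟩ := (hG 0).exists_field (j 0).elementarilyEquivalent
  have hj : ∀ n m (h : n ≤ m) x, j m (f n m h x) = j n x := fun n m h x => DirectLimit.of_f
  have hsurj : ∀ z, ∃ n x, j n x = z := DirectLimit.exists_of
  choose lev rep hrep using hsurj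
  let J : ∀ n, G n →+* K' := fun n => (hG n).ringHom hK' (j n).toEmbedding
  have hJ : ∀ n x, J n x = j n x := fun n x => rfl
  -- Computed on a chosen representative; `hd` shows that the choice does not matter.
  let d : K' → K' := fun z => j (lev z) (D _ (rep z))
  have hd : ∀ n x, d (j n x) = j n (D n x) := by
    intro n x
    have h1 := hj (lev (j n x)) (max n (lev (j n x))) (le_max_right _ _)
    have h2 := hj n (max n (lev (j n x))) (le_max_left _ _)
    have h3 : f _ _ (le_max_right _ _) (rep (j n x)) =
        f n (max n (lev (j n x))) (le_max_left _ _) x := by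
      apply (j _).injective
      rw [h1, h2, hrep]
    change j _ (D _ (rep (j n x))) = _
    rw [← h1, hfD, h3, ← hfD, h2]
  have hpair : ∀ z z' : K', ∃ n x x', j n x = z ∧ j n x' = z' := fun z z' =>
    ⟨max (lev z) (lev z'), f _ _ (le_max_left _ _) (rep z), f _ _ (le_max_right _ _) (rep z'),
      by rw [hj, hrep], by rw [hj, hrep]⟩
  have hd_add : ∀ z z', d (z + z') = d z + d z' := by
    intro z z'
    obtain ⟨n, x, x', rfl, rfl⟩ := hpair z z'
    rw [← hJ, ← hJ, ← map_add, hJ, hJ, hJ, hd, hd, hd, map_add, ← hJ, map_add]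
    rfl
  let D' : Derivation ℤ K' K' := Derivation.mk' (AddMonoidHom.mk' d hd_add).toIntLinearMap (by
    intro z z'
    change d (z * z') = z * d z' + z' * d z
    obtain ⟨n, x, x', rfl, rfl⟩ := hpair z z'
    rw [← hJ, ← hJ, ← map_mul, hJ, hJ, hJ, hd, hd, hd, Derivation.leibniz, ← hJ, map_add,
      smul_eq_mul, smul_eq_mul, map_mul, map_mul]
    rfl)
  refine ⟨K', _, _, D', j, hK', fun n x => ?_, fun n x => (hd n x).symm,
    fun z => ⟨lev z, rep z, hrep z⟩⟩
  rw [← hj n (n + 1) n.le_succ x, hsucc n n le_rfl, hself]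
  rfl

/-! ### The chain of ultrapowers and the conclusion. -/

/-- An expansion of a differential field of characteristic zero satisfying `HasDenseZeros`. -/
structure DenseDiffField {L : FirstOrder.Language.{u, v}} (ι : FirstOrder.Language.ring →ᴸ L)
    {k : ℕ} (χ : L.Formula (Fin 1 ⊕ Fin k)) where
  /-- The underlying set. -/
  carrier : Type w
  [field : Field carrier]
  [str : L.Structure carrier]
  [charZero : CharZero carrier]
  /-- The derivation. -/
  deriv : Derivation ℤ carrier carrier
  isFieldExpansion : IsFieldExpansion ι carrier
  hasDenseZeros : HasDenseZeros χ carrier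

attribute [instance] DenseDiffField.field DenseDiffField.str DenseDiffField.charZero

theorem FirstOrder.Language.ElementaryEmbedding.mem_basicNhd_iff {L : FirstOrder.Language.{u, v}} {k : ℕ}
    (χ : L.Formula (Fin 1 ⊕ Fin k)) {M N : Type*} [L.Structure M] [L.Structure N]
    (e : M ↪ₑ[L] N) (x : M) (a : Fin k → M) :
    e x ∈ basicNhd χ N (fun t => e (a t)) ↔ x ∈ basicNhd χ M a := by
  have := e.map_formula χ (Sum.elim ![x] a)
  simp only [basicNhd, Set.mem_ofPred_eq]
  rw [← this]
  refine iff_of_eq (congrArg χ.Realize ?_)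
  funext b
  rcases b with b | b
  · fin_cases b; rfl
  · rfl

namespace DenseDiffField

variable {L : FirstOrder.Language.{u, v}} {ι : FirstOrder.Language.ring →ᴸ L} {k : ℕ}
  {χ : L.Formula (Fin 1 ⊕ Fin k)}

/-- The extension `e` of differential structures contains solutions of all systems over the smaller
field which are covered by the scheme (DL). -/
def Solves {S T : DenseDiffField.{u, v, w} ι χ} (e : S.carrier ↪ₑ[L] T.carrier) : Prop :=
  ∀ (m : ℕ) (f : MvPolynomial (Fin (m + 1)) S.carrier) (y : Fin (m + 1) → S.carrier)
    (u : Fin (m + 1) → Fin k → S.carrier), MvPolynomial.eval y f = 0 →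
    MvPolynomial.eval y (MvPolynomial.pderiv (Fin.last m) f) ≠ 0 →
    ∃ x : T.carrier,
      MvPolynomial.eval (fun i : Fin (m + 1) => T.deriv^[i] x)
        (MvPolynomial.map (S.isFieldExpansion.ringHom T.isFieldExpansion e.toEmbedding) f) = 0 ∧
      MvPolynomial.eval (fun i : Fin (m + 1) => T.deriv^[i] x)
        (MvPolynomial.map (S.isFieldExpansion.ringHom T.isFieldExpansion e.toEmbedding)
          (MvPolynomial.pderiv (Fin.last m) f)) ≠ 0 ∧
      ∀ i : Fin (m + 1), T.deriv^[i] x - e (y i) ∈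
        basicNhd χ T.carrier (fun t => e (u i t))

theorem exists_solves (S : DenseDiffField.{u, v, w} ι χ) :
    ∃ (T : DenseDiffField.{u, v, w} ι χ) (e : S.carrier ↪ₑ[L] T.carrier),
      (∀ x, e (S.deriv x) = T.deriv (e x)) ∧ Solves e := by
  obtain ⟨I, U, D, hD, hsol⟩ := S.hasDenseZeros.exists_ultrapower_derivation S.deriv
  have : CharZero (Ultrapower U S.carrier) :=
    charZero_of_injective_ringHom (Ultrapower.diagHom U S.carrier).injective
  exact ⟨{ carrier := Ultrapower U S.carrier
           deriv := D
           isFieldExpansion := Ultrapower.isFieldExpansion S.isFieldExpansion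
           hasDenseZeros := S.hasDenseZeros.ultrapower U },
    Ultrapower.diagElementary U S.carrier L, fun x => (hD x).symm, hsol⟩

theorem exists_chain (S : DenseDiffField.{u, v, w} ι χ) :
    ∃ (G : ℕ → DenseDiffField.{u, v, w} ι χ)
      (e : ∀ n, (G n).carrier ↪ₑ[L] (G (n + 1)).carrier), G 0 = S ∧
      (∀ n x, e n ((G n).deriv x) = (G (n + 1)).deriv (e n x)) ∧ ∀ n, Solves (e n) := by
  choose next e he hsol using exists_solves (ι := ι) (χ := χ)
  let G : ℕ → DenseDiffField.{u, v, w} ι χ := fun n => Nat.rec S (fun _ T => next T) n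
  exact ⟨G, fun n => e (G n), rfl, fun n => he (G n), fun n => hsol (G n)⟩

theorem exists_modelsDL (S : DenseDiffField.{u, v, w} ι χ) :
    ∃ (K' : Type w) (_ : Field K') (_ : L.Structure K') (δ' : Derivation ℤ K' K')
      (j : S.carrier ↪ₑ[L] K'),
      IsFieldExpansion ι K' ∧ (∀ x, j (S.deriv x) = δ' (j x)) ∧ ModelsDL χ δ' := by
  obtain ⟨G, e, rfl, he, hsol⟩ := S.exists_chain
  obtain ⟨K', _, _, δ', j, hK', hje, hjD, hjs⟩ := exists_limit_of_elementary_chain (L := L)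
    (fun n => (G n).carrier) (fun n => (G n).isFieldExpansion) (fun n => (G n).deriv)
    e he
  refine ⟨K', _, _, δ', j 0, hK', hjD 0, modelsDL_of_forall ?_⟩
  let J : ∀ n, (G n).carrier →+* K' := fun n =>
    (G n).isFieldExpansion.ringHom hK' (j n).toEmbedding
  have hmono : ∀ n n', n ≤ n' → ∀ z, z ∈ Set.range (J n) → z ∈ Set.range (J n') := by
    intro n n' h z hz
    induction n', h using Nat.le_induction with
    | base => exact hz
    | succ n' h ih =>
      obtain ⟨x, rfl⟩ := ih
      exact ⟨e n' x, hje n' x⟩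
  have hfin : ∀ s : Finset K', ∃ n, ∀ z ∈ s, z ∈ Set.range (J n) := by
    classical
    intro s
    induction s using Finset.induction_on with
    | empty => exact ⟨0, by simp⟩
    | insert z s _ ih =>
      obtain ⟨n, hn⟩ := ih
      obtain ⟨n', x, hx⟩ := hjs z
      refine ⟨max n n', fun z' hz' => ?_⟩
      rcases Finset.mem_insert.1 hz' with rfl | hz'
      · exact hmono n' _ (le_max_right _ _) _ ⟨x, hx⟩
      · exact hmono n _ (le_max_left _ _) _ (hn z' hz')
  intro m f y u hf hs
  classical
  -- The coefficients, the point and the neighbourhood parameters are finitely many, so all come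
  -- from one stage `n`; stage `n + 1` contains a solution.
  obtain ⟨n, hn⟩ := hfin (f.coeffs ∪ Finset.univ.image y ∪
    Finset.univ.image (fun p : Fin (m + 1) × Fin k => u p.1 p.2))
  obtain ⟨f, rfl⟩ := MvPolynomial.mem_range_map_iff_coeffs_subset.2
    (fun z (hz : z ∈ (f.coeffs : Set K')) => hn z (by
      simp only [Finset.mem_union]; exact Or.inl (Or.inl hz)))
  choose y' hy' using fun i => hn (y i) (by simp)
  choose u' hu' using fun i t => hn (u i t) (by
    simp only [Finset.mem_union]
    exact Or.inr (Finset.mem_image.2 ⟨(i, t), Finset.mem_univ _, rfl⟩))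
  obtain rfl : (fun i => J n (y' i)) = y := funext hy'
  obtain rfl : (fun i t => J n (u' i t)) = u := funext fun i => funext (hu' i)
  rw [MvPolynomial.eval_map_comp, map_eq_zero] at hf
  rw [MvPolynomial.pderiv_map, MvPolynomial.eval_map_comp, map_ne_zero] at hs
  obtain ⟨x, h1, h2, h3⟩ := hsol n m f y' u' hf hs
  have hiter : ∀ i : ℕ, δ'^[i] (J (n + 1) x) = J (n + 1) ((G (n + 1)).deriv^[i] x) := by
    intro i
    induction i with
    | zero => rfl
    | succ i ih =>
      rw [Function.iterate_succ_apply', Function.iterate_succ_apply', ih]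
      exact (hjD (n + 1) _).symm
  have hcomp : J n = (J (n + 1)).comp ((G n).isFieldExpansion.ringHom
      (G (n + 1)).isFieldExpansion (e n).toEmbedding) :=
    RingHom.ext fun z => (hje n z).symm
  refine ⟨J (n + 1) x, ?_, ?_, fun i => ?_⟩
  · simp only [hiter]
    rw [hcomp, ← MvPolynomial.map_map, MvPolynomial.eval_map_comp]
    exact (congrArg (J (n + 1)) h1).trans (map_zero _)
  · simp only [hiter]
    rw [MvPolynomial.pderiv_map, hcomp, ← MvPolynomial.map_map, MvPolynomial.eval_map_comp]
    exact (map_ne_zero (J (n + 1))).2 h2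
  · rw [hiter, hcomp]
    simp only [RingHom.comp_apply]
    rw [← map_sub]
    -- Membership in `χ` passes to the union because `j (n + 1)` is elementary.
    exact ((j (n + 1)).mem_basicNhd_iff χ _ _).2 (h3 i)

end DenseDiffField

theorem mainTheorem6 {L : FirstOrder.Language.{u, v}} (ι : FirstOrder.Language.ring →ᴸ L)
    (K : Type w) [Field K] [CharZero K] [L.Structure K] (hK : IsFieldExpansion ι K)
    [TopologicalSpace K] [IsTopologicalDivisionRing K]
    {k : ℕ} (χ : L.Formula (Fin 1 ⊕ Fin k)) (hχ : IsNhdBasisFormula χ K)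
    (δ : Derivation ℤ K K) (hc : IsCLarge L K) :
    ∃ (K' : Type w) (_ : Field K') (_ : L.Structure K') (δ' : Derivation ℤ K' K')
      (j : K ↪[L] K'),
      IsFieldExpansion ι K' ∧
      L.ElementarilyEquivalent K K' ∧
      (∀ x : K, j (δ x) = δ' (j x)) ∧
      ModelsDL χ δ' := by
  let S : DenseDiffField.{u, v, w} ι χ :=
    { carrier := K
      deriv := δ
      isFieldExpansion := hK
      hasDenseZeros := hc.hasDenseZeros hK hχ }
  obtain ⟨K', _, _, δ', j, hK', hj, hDL⟩ := S.exists_modelsDL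
  exact ⟨K', _, _, δ', j.toEmbedding, hK', j.elementarilyEquivalent, hj, hDL⟩
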